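/- For a normed space $X$ over $\mathbb{K}=\mathbb{R}$ or $\mathbb{C}$ with dual space $X^*$, let the $n$-th linear polarization constant of $X$ be $$c_n(X)=\inf\Big\{M : \prod_{j=1}^n\|f_j\|\le M\,\Big\|\prod_{j=1}^n f_j\Big\|\ \text{ for all } f_1,\dots,f_n\in X^*\Big\},\qquad \Big\|\prod_{j=1}^n f_j\Big\|=\sup_{\|x\|\le 1}\prod_{j=1}^n|f_j(x)| .$$ Let $\mathbb{R}^n$ carry the Euclidean norm. Then $$n^{n/2}\le c_n(\mathbb{R}^n)\quad\text{for all integers } n\ge 1,\qquad\text{and}\qquad c_n(\mathbb{R}^n)\le 2^{\frac n2-1}\,n^{n/2}\quad\text{for all integers } n\ge 2.$$ -/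

import Mathlib

open scoped ENNReal

/-- The uniform norm `‖f‖ = sup_{‖x‖ ≤ 1} |f x|` of a function on the closed unit ball of a normed
space, with values in `[0, ∞]`. -/
noncomputable def unitBallNorm {𝕜 X : Type*} [RCLike 𝕜] [NormedAddCommGroup X]
    (f : X → 𝕜) : ℝ≥0∞ :=
  ⨆ x ∈ Metric.closedBall (0 : X) 1, ‖f x‖ₑ

/-- The `n`-th linear polarization constant `c_n(X)` of a normed space `X` over `𝕜 = ℝ` or `ℂ`:
the infimum of all `M` such that `∏ ‖f_j‖ ≤ M ‖∏ f_j‖` for all bounded linear functionals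
`f_1, …, f_n` on `X`, where `‖∏ f_j‖` is the uniform norm on the unit ball of the product.
The infimum is taken in `[0, ∞]`, so that no convention about empty or unbounded sets of real
numbers is involved. -/
noncomputable def linearPolarizationConst (𝕜 X : Type*) [RCLike 𝕜] [NormedAddCommGroup X]
    [NormedSpace 𝕜 X] (n : ℕ) : ℝ≥0∞ :=
  sInf {M : ℝ≥0∞ | ∀ f : Fin n → (X →L[𝕜] 𝕜),
    ∏ j, ‖f j‖ₑ ≤ M * unitBallNorm (fun x : X => ∏ j, f j x)}

/-! The lower bound tests the coordinate functionals: AM-GM on the squares `x j ^ 2` bounds their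
product by `n ^ (-n/2)` on the unit ball.

For the upper bound, Riesz representation and scaling reduce to real unit vectors `v j` whose
product of inner products is at most `m` on the real ball. The complex plank theorem gives a complex
unit vector `z` where the product of moduli is at least `n ^ (-n/2)`. After a unimodular rotation,
`z = x + i y` with `x ⟂ y`. On the circle spanned by `x` and `y` the product is, up to a phase, a
self-reciprocal polynomial in `u = exp (2iθ)`, and its value inside the disc at `(‖x‖ - ‖y‖) / (‖x‖
+ ‖y‖)` recovers the product at `z`. The gain `(1 + ‖u‖ ^ n) / 2` over the maximum principle is what
yields `2 ^ (n/2 - 1)` instead of `2 ^ (n/2)`. -/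

/-! ### The complex plank theorem -/

/-- Boundary version of the Schwarz lemma. -/
theorem one_le_of_hasDerivAt_of_norm_le_one {Q : ℂ → ℂ} (hQ : Differentiable ℂ Q)
    (hQ0 : Q 0 = 0) (hQ1 : Q 1 = 1) (hle : ∀ w, ‖w‖ < 1 → ‖Q w‖ ≤ 1) {d : ℝ}
    (hd : HasDerivAt (fun x : ℝ => (Q x).re) d 1) : 1 ≤ d := by
  have hS : ∀ w : ℂ, ‖w‖ < 1 → ‖Q w‖ ≤ ‖w‖ := fun w hw =>
    Complex.norm_le_norm_of_mapsTo_ball (R := 1) hQ.differentiableOn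
      (fun y hy => by simpa using hle y (by simpa using hy)) hQ0 hw
  have ht := hd.hasDerivWithinAt (s := Set.Iio 1)
  rw [hasDerivWithinAt_iff_tendsto_slope' (by simp)] at ht
  refine ge_of_tendsto ht ?_
  have h0 : Set.Ioi (0 : ℝ) ∈ nhdsWithin (1 : ℝ) (Set.Iio 1) :=
    mem_nhdsWithin_of_mem_nhds (Ioi_mem_nhds one_pos)
  filter_upwards [self_mem_nhdsWithin, h0] with x hx hx0
  simp only [Set.mem_Iio, Set.mem_Ioi] at hx hx0
  have hn : ‖(x : ℂ)‖ = x := by simp [abs_of_pos hx0]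
  have h1 := (Complex.re_le_norm (Q x)).trans (hS x (by rw [hn]; exact hx))
  rw [hn] at h1
  rw [slope_def_field, le_div_iff_of_neg (by linarith)]
  simp only [Complex.ofReal_one, hQ1, Complex.one_re]
  linarith

/-- A unit vector at which `∏ ‖⟪v j, z⟫‖` is maximal and nonzero, with the homogeneous form of
maximality. -/
theorem exists_unit_prod_inner_max {E ι : Type*} [NormedAddCommGroup E] [InnerProductSpace ℂ E]
    [FiniteDimensional ℂ E] [Fintype ι] [Nonempty ι] (v : ι → E) (hv : ∀ j, ‖v j‖ = 1) :
    ∃ z : E, ‖z‖ = 1 ∧ (∀ j, inner ℂ (v j) z ≠ 0) ∧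
      ∀ y, ∏ j, ‖inner ℂ (v j) y‖ ≤ (∏ j, ‖inner ℂ (v j) z‖) * ‖y‖ ^ Fintype.card ι := by
  have : ProperSpace E := FiniteDimensional.proper ℂ E
  -- Finitely many hyperplanes do not cover `E`, so the maximum is positive.
  obtain ⟨x, hx⟩ := Module.Dual.exists_forall_ne_zero_of_forall_exists
    (K := ℂ) (M := E) (fun j => (innerSL ℂ (v j)).toLinearMap) (fun j => ⟨v j, by
      simp [hv j]⟩)
  have hx' : ∀ j, inner ℂ (v j) x ≠ 0 := fun j => by simpa using hx j
  have hx0 : x ≠ 0 := by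
    rintro rfl
    exact hx' (Classical.arbitrary ι) (by simp)
  have hcont : Continuous fun y : E => ∏ j, ‖inner ℂ (v j) y‖ := by fun_prop
  have hhom : ∀ (y : E), y ≠ 0 → ∏ j, ‖inner ℂ (v j) y‖ =
      (∏ j, ‖inner ℂ (v j) (((‖y‖⁻¹ : ℝ) : ℂ) • y)‖) * ‖y‖ ^ Fintype.card ι := by
    intro y hy
    have : ‖y‖ ≠ 0 := norm_ne_zero_iff.2 hy
    rw [← Finset.card_univ, ← Finset.prod_const, ← Finset.prod_mul_distrib]
    refine Finset.prod_congr rfl fun j _ => ?_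
    rw [inner_smul_right, norm_mul, Complex.norm_real, norm_inv, norm_norm]
    field_simp
  have hunit : ∀ (y : E), y ≠ 0 → (((‖y‖⁻¹ : ℝ) : ℂ) • y) ∈ Metric.sphere (0 : E) 1 := by
    intro y hy
    have : ‖y‖ ≠ 0 := norm_ne_zero_iff.2 hy
    rw [mem_sphere_zero_iff_norm, norm_smul, Complex.norm_real, norm_inv, norm_norm]
    field_simp
  obtain ⟨z, hz, hmax⟩ := (isCompact_sphere (0 : E) 1).exists_isMaxOn ⟨_, hunit x hx0⟩
    hcont.continuousOn
  have hle : ∀ y, ∏ j, ‖inner ℂ (v j) y‖ ≤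
      (∏ j, ‖inner ℂ (v j) z‖) * ‖y‖ ^ Fintype.card ι := by
    intro y
    rcases eq_or_ne y 0 with rfl | hy
    · simp [Fintype.card_ne_zero]
    · rw [hhom y hy]
      exact mul_le_mul_of_nonneg_right (hmax (hunit y hy)) (by positivity)
  refine ⟨z, by simpa using hz, fun j hj => ?_, hle⟩
  have h1 := hle x
  have h2 : ∏ i, ‖inner ℂ (v i) z‖ = 0 :=
    Finset.prod_eq_zero (Finset.mem_univ j) (by rw [hj, norm_zero])
  rw [h2, zero_mul] at h1
  exact absurd h1 (not_le.2 (Finset.prod_pos fun i _ => norm_pos_iff.2 (hx' i)))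

/-- Ball's complex plank theorem for planks of equal width. -/
theorem exists_unit_one_le_card_mul_norm_inner_sq {E ι : Type*} [NormedAddCommGroup E]
    [InnerProductSpace ℂ E] [FiniteDimensional ℂ E] [Fintype ι] [Nonempty ι] (v : ι → E)
    (hv : ∀ j, ‖v j‖ = 1) :
    ∃ z : E, ‖z‖ = 1 ∧ ∀ j, 1 ≤ Fintype.card ι * ‖inner ℂ (v j) z‖ ^ 2 := by
  obtain ⟨z, hz, hne, hmax⟩ := exists_unit_prod_inner_max v hv
  refine ⟨z, hz, fun k => ?_⟩
  set c := inner ℂ (v k) z with hc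
  set n := Fintype.card ι
  -- The perturbation multiplies the component of `z` along `v k` by `w`: it stays in the unit ball
  -- for `‖w‖ ≤ 1`, and at `w = 0` the `k`-th factor vanishes.
  let Q : ℂ → ℂ := fun w => ∏ j, (inner ℂ (v j) (z + ((w - 1) * c) • v k) / inner ℂ (v j) z)
  have hnorm : ∀ w : ℂ, ‖z + ((w - 1) * c) • v k‖ ^ 2 = 1 + ‖c‖ ^ 2 * (‖w‖ ^ 2 - 1) := by
    intro w
    have h1 : z + ((w - 1) * c) • v k = (z - c • v k) + (w * c) • v k := by module
    have hkk : inner ℂ (v k) (v k) = (1 : ℂ) := by simp [inner_self_eq_norm_sq_to_K, hv]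
    have horth : inner ℂ (v k) (z - c • v k) = (0 : ℂ) := by
      rw [inner_sub_right, inner_smul_right, hkk, ← hc]; ring
    have horth' : ∀ a : ℂ, inner ℂ (z - c • v k) (a • v k) = (0 : ℂ) := by
      intro a
      rw [inner_smul_right, ← inner_conj_symm, horth]; simp
    have h2 := norm_add_sq_eq_norm_sq_add_norm_sq_of_inner_eq_zero _ _ (horth' (w * c))
    have h3 := norm_add_sq_eq_norm_sq_add_norm_sq_of_inner_eq_zero _ _ (horth' c)
    rw [sub_add_cancel, hz] at h3
    simp only [norm_smul, norm_mul, hv k] at h2 h3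
    rw [h1]
    nlinarith
  have hQle : ∀ w, ‖Q w‖ ≤ ‖z + ((w - 1) * c) • v k‖ ^ n := by
    intro w
    simp only [Q, norm_prod, norm_div, Finset.prod_div_distrib]
    rw [div_le_iff₀' (Finset.prod_pos fun i _ => norm_pos_iff.2 (hne i))]
    exact hmax _
  have hQd : Differentiable ℂ Q := by
    have : Q = fun w => ∏ j,
        ((inner ℂ (v j) z + ((w - 1) * c) * inner ℂ (v j) (v k)) / inner ℂ (v j) z) := by
      funext w
      simp only [Q, inner_add_right, inner_smul_right]
    rw [this]
    fun_prop
  have hQ1 : Q 1 = 1 := by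
    simp only [Q, sub_self, zero_mul, zero_smul, add_zero]
    exact Finset.prod_eq_one fun j _ => div_self (hne j)
  have hQ0 : Q 0 = 0 := by
    refine Finset.prod_eq_zero (Finset.mem_univ k) ?_
    rw [inner_add_right, inner_smul_right, inner_self_eq_norm_sq_to_K, hv]
    simp [hc]
  have hQdisc : ∀ w, ‖w‖ < 1 → ‖Q w‖ ≤ 1 := by
    intro w hw
    refine (hQle w).trans (pow_le_one₀ (norm_nonneg _) ?_)
    have h1 : ‖w‖ ^ 2 ≤ 1 := pow_le_one₀ (norm_nonneg _) hw.le
    have h2 : ‖z + ((w - 1) * c) • v k‖ ^ 2 ≤ 1 := by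
      rw [hnorm]; nlinarith [sq_nonneg ‖c‖]
    exact (sq_le_one_iff₀ (norm_nonneg _)).1 h2
  have hder : HasDerivAt (fun x : ℝ => (Q x).re) (deriv Q ((1 : ℝ) : ℂ)).re 1 :=
    HasDerivAt.real_of_complex (hQd _).hasDerivAt
  have hone := one_le_of_hasDerivAt_of_norm_le_one hQd hQ0 hQ1 hQdisc hder
  -- `t ≤ (1 + t ^ 2) / 2` avoids a square root and keeps the derivative at `1`. Both sides agree at
  -- `x = 1`, so tangency forces `Q' = n * ‖c‖ ^ 2` there, while Schwarz gives real part at least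
  -- `1`.
  have hupper : ∀ x : ℝ, (Q x).re ≤ (1 + ‖c‖ ^ 2 * (x ^ 2 - 1) / 2) ^ n := by
    intro x
    refine (Complex.re_le_norm _).trans ((hQle x).trans (pow_le_pow_left₀ (norm_nonneg _) ?_ _))
    have h1 := hnorm x
    rw [Complex.norm_real, Real.norm_eq_abs, sq_abs] at h1
    nlinarith [sq_nonneg (‖z + (((x : ℂ) - 1) * c) • v k‖ - 1)]
  have hder2 : HasDerivAt (fun x : ℝ => (1 + ‖c‖ ^ 2 * (x ^ 2 - 1) / 2) ^ n)
      (n * ‖c‖ ^ 2) 1 := by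
    have h1 : HasDerivAt (fun x : ℝ => 1 + ‖c‖ ^ 2 * (x ^ 2 - 1) / 2)
        (‖c‖ ^ 2 * ((2 : ℕ) * (1 : ℝ) ^ (2 - 1)) / 2) 1 :=
      ((((hasDerivAt_pow 2 (1 : ℝ)).sub_const 1).const_mul (‖c‖ ^ 2)).div_const 2).const_add 1
    exact (h1.fun_pow n).congr_deriv (by simp)
  have hmin : IsLocalMin (fun x : ℝ => (1 + ‖c‖ ^ 2 * (x ^ 2 - 1) / 2) ^ n - (Q x).re) 1 := by
    refine Filter.Eventually.of_forall fun x => ?_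
    simp only [Complex.ofReal_one, hQ1]
    have := hupper x
    simp only [one_pow, sub_self, mul_zero, zero_div, add_zero, Complex.one_re]
    linarith
  have := hmin.hasDerivAt_eq_zero (hder2.sub hder)
  linarith

/-! ### From complex points to the real unit ball -/

open scoped ComplexConjugate in
/-- A product of self-reciprocal linear factors bounded by `m` on the unit circle is bounded by
`m (1 + ‖u‖ ^ n) / 2` inside the disc. -/
theorem two_mul_norm_prod_add_conj_mul_le {ι : Type*} [Fintype ι] (γ : ι → ℂ) {m : ℝ}
    (hm : ∀ u : ℂ, ‖u‖ = 1 → ‖∏ j, (γ j + conj (γ j) * u)‖ ≤ m) {u : ℂ} (hu : ‖u‖ ≤ 1) :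
    2 * ‖∏ j, (γ j + conj (γ j) * u)‖ ≤ m * (1 + ‖u‖ ^ Fintype.card ι) := by
  set n := Fintype.card ι
  set f : ℂ → ℂ := fun w => ∏ j, (γ j + conj (γ j) * w) with hf
  change 2 * ‖f u‖ ≤ _
  have hfd : Differentiable ℂ f := by fun_prop
  have hfr : frontier (Metric.ball (0 : ℂ) 1) = Metric.sphere 0 1 := frontier_ball _ one_ne_zero
  have hcl : closure (Metric.ball (0 : ℂ) 1) = Metric.closedBall 0 1 := closure_ball _ one_ne_zero
  have hmax : ∀ w : ℂ, ‖w‖ ≤ 1 → ‖f w‖ ≤ m := fun w hw =>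
    Complex.norm_le_of_forall_mem_frontier_norm_le (U := Metric.ball (0 : ℂ) 1)
      Metric.isBounded_ball hfd.diffContOnCl
      (fun z hz => hm z (by simpa [hfr] using hz)) (by simpa [hcl] using hw)
  have hself : ∀ w : ℂ, ‖w‖ = 1 → f w = w ^ n * conj (f w) := by
    intro w hw
    have hww : w * conj w = 1 := by rw [Complex.mul_conj']; simp [hw]
    simp only [hf, map_prod, n, ← Finset.card_univ]
    rw [← Finset.prod_const, ← Finset.prod_mul_distrib]
    refine Finset.prod_congr rfl fun j _ => ?_
    simp only [map_add, map_mul, Complex.conj_conj]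
    linear_combination (-γ j) * hww
  -- Strict inequality keeps the denominator `f w - Λ * l` away from zero. By self-reciprocity the
  -- quotient in `hq` is unimodular on the circle; choosing `l` as the phase of `f u` makes the
  -- denominator's norm exactly `Λ - ‖f u‖` at `u`.
  have key : ∀ Λ : ℝ, m < Λ → 2 * ‖f u‖ ≤ Λ * (1 + ‖u‖ ^ n) := by
    intro Λ hΛ
    have hΛ0 : 0 < Λ := ((norm_nonneg _).trans (hmax u hu)).trans_lt hΛ
    obtain ⟨l, hl, hfl⟩ : ∃ l : ℂ, ‖l‖ = 1 ∧ f u = ‖f u‖ * l := by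
      refine ⟨Complex.exp (Complex.arg (f u) * Complex.I), Complex.norm_exp_ofReal_mul_I _, ?_⟩
      exact (Complex.norm_mul_exp_arg_mul_I _).symm
    have hG : ∀ w : ℂ, ‖w‖ ≤ 1 → f w - Λ * l ≠ 0 := by
      intro w hw h0
      have h1 := hmax w hw
      rw [sub_eq_zero.1 h0, norm_mul, hl, Complex.norm_real, Real.norm_of_nonneg hΛ0.le] at h1
      linarith
    have hq : ‖(f u - Λ * conj l * u ^ n) / (f u - Λ * l)‖ ≤ 1 := by
      refine Complex.norm_le_of_forall_mem_frontier_norm_le (U := Metric.ball (0 : ℂ) 1)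
        (f := fun w => (f w - Λ * conj l * w ^ n) / (f w - Λ * l))
        Metric.isBounded_ball ?_ ?_ (by simpa [hcl] using hu)
      · refine DifferentiableOn.diffContOnCl ?_
        rw [hcl]
        refine DifferentiableOn.div (Differentiable.differentiableOn (by fun_prop))
          (Differentiable.differentiableOn (by fun_prop)) fun w hw => hG w (by simpa using hw)
      · intro w hw
        have hw : ‖w‖ = 1 := by simpa [hfr] using hw
        have h1 : f w - Λ * conj l * w ^ n = w ^ n * conj (f w - Λ * l) := by
          simp only [map_sub, map_mul, Complex.conj_ofReal]
          linear_combination hself w hw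
        rw [h1, norm_div, norm_mul, norm_pow, hw, one_pow, one_mul, Complex.norm_conj]
        exact (div_self (norm_ne_zero_iff.2 (hG w hw.le))).le
    rw [norm_div, div_le_one (norm_pos_iff.2 (hG u hu))] at hq
    have h2 : ‖f u - Λ * l‖ = Λ - ‖f u‖ := by
      have : f u - Λ * l = ((‖f u‖ - Λ : ℝ) : ℂ) * l := by
        push_cast; linear_combination hfl
      rw [this, norm_mul, hl, Complex.norm_real, Real.norm_eq_abs, mul_one,
        abs_of_nonpos (by linarith [hmax u hu]), neg_sub]
    have h3 := norm_sub_norm_le (f u) (Λ * conj l * u ^ n)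
    rw [norm_mul, norm_mul, Complex.norm_conj, hl, norm_pow, Complex.norm_real,
      Real.norm_of_nonneg hΛ0.le] at h3
    linarith
  refine le_of_forall_gt_imp_ge_of_dense fun a ha => ?_
  have hp : 0 < 1 + ‖u‖ ^ n := by positivity
  have := key (a / (1 + ‖u‖ ^ n)) (by rwa [lt_div_iff₀ hp])
  rwa [div_mul_cancel₀ _ hp.ne'] at this

/-- The complexification estimate for a product of real linear forms at `x + i y`. -/
theorem two_mul_prod_norm_inner_add_inner_mul_I_le {F ι : Type*} [NormedAddCommGroup F]
    [InnerProductSpace ℝ F] [Fintype ι] (v : ι → F) {m : ℝ}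
    (hm : ∀ e : F, ‖e‖ ≤ 1 → ∏ j, |inner ℝ (v j) e| ≤ m) {x y : F} (hxy : inner ℝ x y = 0)
    (hle : ‖y‖ ≤ ‖x‖) :
    2 * ∏ j, ‖((inner ℝ (v j) x : ℝ) : ℂ) + (inner ℝ (v j) y : ℝ) * Complex.I‖ ≤
      m * ((‖x‖ + ‖y‖) ^ Fintype.card ι + (‖x‖ - ‖y‖) ^ Fintype.card ι) := by
  set n := Fintype.card ι with hn
  have hconst : ∀ r : ℝ, r ^ n = ∏ _j : ι, r := fun r => by
    rw [Finset.prod_const, Finset.card_univ]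
  set a := ‖x‖ with ha
  set b := ‖y‖ with hb
  rcases eq_or_ne x 0 with hx0 | hx0
  · have ha0 : a = 0 := by rw [ha, hx0, norm_zero]
    have hb0 : b = 0 := le_antisymm (by rw [← ha0]; exact hle) (norm_nonneg _)
    have hy0 : y = 0 := norm_eq_zero.1 hb0
    have h1 := hm 0 (by simp)
    have h2 : 0 ≤ ∏ j, |inner ℝ (v j) (0 : F)| := Finset.prod_nonneg fun _ _ => abs_nonneg _
    simp only [ha0, hb0, hx0, hy0, inner_zero_right, Complex.ofReal_zero, zero_mul, add_zero,
      norm_zero, sub_zero, abs_zero, ← hconst] at *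
    have h3 : (0 : ℝ) ≤ 0 ^ n := pow_nonneg le_rfl _
    have h4 : (0 : ℝ) ^ n ≤ 1 := pow_le_one₀ le_rfl zero_le_one
    -- The empty product is separate because `0 ^ 0 = 1`.
    rcases eq_or_ne n 0 with h0 | h0
    · rw [h0] at h1 ⊢
      simp only [pow_zero] at *
      linarith
    · simp [h0]
  have hapos : 0 < a := norm_pos_iff.2 hx0
  rcases eq_or_ne y 0 with hy0 | hy0
  · have hb0 : b = 0 := by rw [hb, hy0, norm_zero]
    have h1 := hm (a⁻¹ • x) (by
      rw [norm_smul, norm_inv, Real.norm_of_nonneg hapos.le, ← ha, inv_mul_cancel₀ hapos.ne'])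
    have h2 : ∏ j, ‖((inner ℝ (v j) x : ℝ) : ℂ) + (inner ℝ (v j) y : ℝ) * Complex.I‖ =
        (∏ j, |inner ℝ (v j) (a⁻¹ • x)|) * a ^ n := by
      rw [hconst, ← Finset.prod_mul_distrib]
      refine Finset.prod_congr rfl fun j _ => ?_
      rw [hy0, inner_smul_right, inner_zero_right, abs_mul, abs_inv, abs_of_pos hapos]
      simp only [Complex.ofReal_zero, zero_mul, add_zero, Complex.norm_real, Real.norm_eq_abs]
      field_simp
    have h3 := mul_le_mul_of_nonneg_right h1 (pow_nonneg hapos.le n)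
    rw [h2, hb0, add_zero, sub_zero]
    linarith
  have hbpos : 0 < b := norm_pos_iff.2 hy0
  set α : ι → ℝ := fun j => inner ℝ (v j) x / a with hα
  set β : ι → ℝ := fun j => inner ℝ (v j) y / b with hβ
  set γ : ι → ℂ := fun j => ((α j : ℂ) + β j * Complex.I) / 2 with hγ
  have hconj : ∀ j, starRingEnd ℂ (γ j) = ((α j : ℂ) - β j * Complex.I) / 2 := by
    intro j
    rw [hγ]
    simp only [map_div₀, map_add, map_mul, Complex.conj_ofReal, Complex.conj_I, Complex.conj_ofNat]
    ring
  have hcirc : ∀ u : ℂ, ‖u‖ = 1 → ‖∏ j, (γ j + starRingEnd ℂ (γ j) * u)‖ ≤ m := by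
    intro u hu
    obtain ⟨θ, hθ⟩ : ∃ θ : ℝ, u = Complex.exp (θ * Complex.I) ^ 2 := by
      refine ⟨Complex.arg u / 2, ?_⟩
      rw [← Complex.exp_nat_mul]
      have := Complex.norm_mul_exp_arg_mul_I u
      rw [hu, Complex.ofReal_one, one_mul] at this
      rw [← this]
      congr 1
      rw [this]
      push_cast
      ring
    have he : ‖Real.cos θ • (a⁻¹ • x) + Real.sin θ • (b⁻¹ • y)‖ ≤ 1 := by
      have h1 : ‖Real.cos θ • (a⁻¹ • x) + Real.sin θ • (b⁻¹ • y)‖ ^ 2 = 1 := by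
        rw [norm_add_sq_real]
        simp only [inner_smul_left, inner_smul_right, hxy, norm_smul, Real.norm_eq_abs, mul_pow,
          sq_abs, ← ha, ← hb]
        have h2 := Real.cos_sq_add_sin_sq θ
        rw [← mul_pow a⁻¹, ← mul_pow b⁻¹, inv_mul_cancel₀ hapos.ne', inv_mul_cancel₀ hbpos.ne']
        linear_combination h2
      exact (sq_le_one_iff₀ (norm_nonneg _)).1 h1.le
    refine le_of_eq_of_le ?_ (hm _ he)
    rw [norm_prod]
    refine Finset.prod_congr rfl fun j _ => ?_
    have h1 : γ j + starRingEnd ℂ (γ j) * u = Complex.exp (θ * Complex.I) *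
        ((Real.cos θ * α j + Real.sin θ * β j : ℝ) : ℂ) := by
      have h2 : (Real.cos θ : ℂ) ^ 2 + (Real.sin θ : ℂ) ^ 2 = 1 := by
        exact_mod_cast Real.cos_sq_add_sin_sq θ
      rw [hconj, hθ, Complex.exp_mul_I, ← Complex.ofReal_cos, ← Complex.ofReal_sin]
      simp only [hγ]
      push_cast only [Complex.ofReal_add, Complex.ofReal_mul]
      linear_combination (-((α j : ℂ) + Complex.I * β j) / 2) * h2 +
        ((α j : ℂ) * (Real.sin θ : ℂ) ^ 2 / 2 - β j * (Real.cos θ : ℂ) * (Real.sin θ : ℂ) -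
          Complex.I * β j * (Real.sin θ : ℂ) ^ 2 / 2) * Complex.I_sq
    rw [h1, norm_mul, Complex.norm_exp_ofReal_mul_I, one_mul, Complex.norm_real,
      Real.norm_eq_abs]
    congr 1
    simp only [hα, hβ, inner_add_right, inner_smul_right]
    ring
  have hab : 0 < a + b := by positivity
  have hτ0 : 0 ≤ (a - b) / (a + b) := div_nonneg (sub_nonneg.2 hle) hab.le
  have hτn : ‖(((a - b) / (a + b) : ℝ) : ℂ)‖ = (a - b) / (a + b) := by
    rw [Complex.norm_real, Real.norm_of_nonneg hτ0]
  have hmain := two_mul_norm_prod_add_conj_mul_le γ hcirc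
    -- Here `1 + u = 2a / (a + b)` and `1 - u = 2b / (a + b)`, so each factor is `(⟪v j, x⟫ + i ⟪v
    -- j, y⟫) / (a + b)`.
    (u := (((a - b) / (a + b) : ℝ) : ℂ)) (by
      rw [hτn, div_le_one hab]; linarith)
  rw [hτn, ← hn] at hmain
  have hprod : ∏ j, ‖((inner ℝ (v j) x : ℝ) : ℂ) + (inner ℝ (v j) y : ℝ) * Complex.I‖ =
      ‖∏ j, (γ j + starRingEnd ℂ (γ j) * (((a - b) / (a + b) : ℝ) : ℂ))‖ * (a + b) ^ n := by
    rw [hconst, norm_prod, ← Finset.prod_mul_distrib]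
    refine Finset.prod_congr rfl fun j _ => ?_
    have habn : ‖((a + b : ℝ) : ℂ)‖ = a + b := by
      rw [Complex.norm_real, Real.norm_of_nonneg hab.le]
    rw [hconj]
    refine Eq.trans ?_ (congrArg (_ * ·) habn)
    rw [← norm_mul]
    congr 1
    have hac : (a : ℂ) ≠ 0 := by exact_mod_cast hapos.ne'
    have hbc : (b : ℂ) ≠ 0 := by exact_mod_cast hbpos.ne'
    have habc : (a : ℂ) + b ≠ 0 := by exact_mod_cast hab.ne'
    simp only [hγ, hα, hβ]
    push_cast
    field_simp
    ring
  rw [hprod]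
  have h3 := mul_le_mul_of_nonneg_right hmain (pow_nonneg hab.le n)
  have h4 : ((a - b) / (a + b)) ^ n * (a + b) ^ n = (a - b) ^ n := by
    rw [← mul_pow, div_mul_cancel₀ _ hab.ne']
  linear_combination h3 + m * h4

/-- Every complex vector is, up to a unimodular factor, `x + i y` with `x ⟂ y` and `‖y‖ ≤ ‖x‖`. -/
theorem exists_orthogonal_re_im {d : Type*} [Fintype d] (z : EuclideanSpace ℂ d) :
    ∃ x y : EuclideanSpace ℝ d, ‖x‖ ^ 2 + ‖y‖ ^ 2 = ‖z‖ ^ 2 ∧ inner ℝ x y = 0 ∧ ‖y‖ ≤ ‖x‖ ∧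
      ∀ v : EuclideanSpace ℝ d,
        ‖((inner ℝ v x : ℝ) : ℂ) + (inner ℝ v y : ℝ) * Complex.I‖ =
          ‖inner ℂ (WithLp.toLp 2 fun i => (v i : ℂ)) z‖ := by
  set S : ℂ := ∑ i, z i ^ 2 with hS
  -- The rotated sum of squares is `‖x‖ ^ 2 - ‖y‖ ^ 2 + 2i ⟪x, y⟫`; making it real and nonnegative
  -- gives both orthogonality and `‖y‖ ≤ ‖x‖`.
  obtain ⟨l, hl, hSl⟩ : ∃ l : ℂ, ‖l‖ = 1 ∧ l ^ 2 * S = ‖S‖ := by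
    refine ⟨Complex.exp ((-(Complex.arg S) / 2 : ℝ) * Complex.I),
      Complex.norm_exp_ofReal_mul_I _, ?_⟩
    nth_rw 2 [← Complex.norm_mul_exp_arg_mul_I S]
    rw [← Complex.exp_nat_mul, mul_left_comm, ← Complex.exp_add]
    have : ((2 : ℕ) : ℂ) * (((-(Complex.arg S) / 2 : ℝ) : ℂ) * Complex.I) +
        Complex.arg S * Complex.I = 0 := by
      push_cast; ring
    rw [this, Complex.exp_zero, mul_one]
  let x : EuclideanSpace ℝ d := WithLp.toLp 2 fun i => (l * z i).re
  let y : EuclideanSpace ℝ d := WithLp.toLp 2 fun i => (l * z i).im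
  have hx2 : ‖x‖ ^ 2 = ∑ i, (l * z i).re ^ 2 := by
    rw [EuclideanSpace.real_norm_sq_eq]
  have hy2 : ‖y‖ ^ 2 = ∑ i, (l * z i).im ^ 2 := by
    rw [EuclideanSpace.real_norm_sq_eq]
  have hin : ∀ u w : EuclideanSpace ℝ d, inner ℝ u w = ∑ i, u i * w i := by
    intro u w
    rw [PiLp.inner_apply]
    refine Finset.sum_congr rfl fun i _ => ?_
    simp [mul_comm]
  have hsum : ∑ i, (l * z i) ^ 2 = ‖S‖ := by
    rw [← hSl, hS, Finset.mul_sum]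
    exact Finset.sum_congr rfl fun i _ => by ring
  refine ⟨x, y, ?_, ?_, ?_, ?_⟩
  · rw [hx2, hy2, EuclideanSpace.norm_sq_eq, ← Finset.sum_add_distrib]
    refine Finset.sum_congr rfl fun i _ => ?_
    have : ‖l * z i‖ ^ 2 = (l * z i).re ^ 2 + (l * z i).im ^ 2 := by
      rw [Complex.sq_norm, Complex.normSq_apply]; ring
    rw [← this, norm_mul, hl, one_mul]
  · have h1 := congrArg Complex.im hsum
    rw [Complex.im_sum, Complex.ofReal_im] at h1
    have h2 : ∀ i, ((l * z i) ^ 2).im = 2 * ((l * z i).re * (l * z i).im) := fun i => by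
      rw [sq, Complex.mul_im]; ring
    simp only [h2, ← Finset.mul_sum] at h1
    rw [hin]
    change ∑ i, (l * z i).re * (l * z i).im = 0
    linarith
  · have h1 := congrArg Complex.re hsum
    rw [Complex.re_sum, Complex.ofReal_re] at h1
    have h2 : ∀ i, ((l * z i) ^ 2).re = (l * z i).re ^ 2 - (l * z i).im ^ 2 := fun i => by
      rw [sq, Complex.mul_re]; ring
    simp only [h2, Finset.sum_sub_distrib] at h1
    refine (sq_le_sq₀ (norm_nonneg _) (norm_nonneg _)).1 ?_
    rw [hx2, hy2]
    linarith [norm_nonneg S]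
  · intro v
    have h1 : ((inner ℝ v x : ℝ) : ℂ) + (inner ℝ v y : ℝ) * Complex.I =
        l * inner ℂ (WithLp.toLp 2 fun i => (v i : ℂ)) z := by
      rw [hin, hin, PiLp.inner_apply, Finset.mul_sum, Complex.ofReal_sum, Complex.ofReal_sum,
        Finset.sum_mul, ← Finset.sum_add_distrib]
      refine Finset.sum_congr rfl fun i _ => ?_
      have h2 := Complex.re_add_im (l * z i)
      have h3 : inner ℂ ((WithLp.toLp 2 fun i => (v i : ℂ) : EuclideanSpace ℂ d) i) (z i) =
          z i * v i := by
        simp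
      have hxi : x i = (l * z i).re := rfl
      have hyi : y i = (l * z i).im := rfl
      rw [h3, hxi, hyi]
      push_cast
      linear_combination (v i : ℂ) * h2
    rw [h1, norm_mul, hl, one_mul]

/-! ### Estimates for products of real linear forms -/

theorem sqrt_natCast_pow_eq_rpow (n k : ℕ) : √(n : ℝ) ^ k = (n : ℝ) ^ ((k : ℝ) / 2) := by
  rw [Real.sqrt_eq_rpow, ← Real.rpow_natCast, ← Real.rpow_mul (Nat.cast_nonneg n)]
  congr 1
  ring

/-- Superadditivity of `t ↦ t ^ (n/2)` applied to `(a + b) ^ 2` and `(a - b) ^ 2`. It needs `n/2 ≥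
1`, and for `n = 1` the inequality fails when `b = 0 < a`. -/
theorem add_pow_add_sub_pow_le {a b : ℝ} (hb : 0 ≤ b) (hab : b ≤ a) {n : ℕ} (hn : 2 ≤ n) :
    (a + b) ^ n + (a - b) ^ n ≤ (2 * (a ^ 2 + b ^ 2)) ^ ((n : ℝ) / 2) := by
  have h : ∀ t : ℝ, 0 ≤ t → t ^ n = (t ^ 2) ^ ((n : ℝ) / 2) := by
    intro t ht
    rw [← Real.rpow_natCast t 2, ← Real.rpow_mul ht, ← Real.rpow_natCast t n]
    congr 1
    push_cast
    ring
  rw [h _ (by linarith), h _ (by linarith)]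
  have h1 : (1 : ℝ) ≤ (n : ℝ) / 2 := by
    have : (2 : ℝ) ≤ n := by exact_mod_cast hn
    linarith
  refine (Real.add_rpow_le_rpow_add (sq_nonneg _) (sq_nonneg _) h1).trans_eq ?_
  congr 1
  ring

/-- The upper polarization estimate for unit vectors. -/
theorem one_le_mul_of_prod_abs_inner_le {d ι : Type*} [Fintype d] [Fintype ι]
    (hn : 2 ≤ Fintype.card ι) (v : ι → EuclideanSpace ℝ d) (hv : ∀ j, ‖v j‖ = 1) {m : ℝ}
    (hm : ∀ e, ‖e‖ ≤ 1 → ∏ j, |inner ℝ (v j) e| ≤ m) :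
    1 ≤ (2 : ℝ) ^ ((Fintype.card ι : ℝ) / 2 - 1) *
      (Fintype.card ι : ℝ) ^ ((Fintype.card ι : ℝ) / 2) * m := by
  have : Nonempty ι := Fintype.card_pos_iff.1 (by omega)
  set n := Fintype.card ι with hcard
  have hm0 : 0 ≤ m := (Finset.prod_nonneg fun _ _ => abs_nonneg _).trans (hm 0 (by simp))
  obtain ⟨z, hz, hzv⟩ := exists_unit_one_le_card_mul_norm_inner_sq
    (fun j => (WithLp.toLp 2 fun i => (v j i : ℂ) : EuclideanSpace ℂ d)) (fun j => by
      rw [← hv j, EuclideanSpace.norm_eq, EuclideanSpace.norm_eq]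
      simp)
  obtain ⟨x, y, hnorm, hxy, hle, hin⟩ := exists_orthogonal_re_im z
  have h1 := two_mul_prod_norm_inner_add_inner_mul_I_le v hm hxy hle
  have h2 := add_pow_add_sub_pow_le (norm_nonneg y) hle hn
  rw [hnorm, hz, one_pow, mul_one] at h2
  rw [← hcard] at h1
  simp only [hin] at h1
  set p := ∏ j, ‖inner ℂ (WithLp.toLp 2 fun i => (v j i : ℂ) : EuclideanSpace ℂ d) z‖ with hp
  have h3 : 1 ≤ (n : ℝ) ^ ((n : ℝ) / 2) * p := by
    rw [← sqrt_natCast_pow_eq_rpow, hp]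
    nth_rw 2 [hcard]
    rw [← Finset.card_univ, ← Finset.prod_const, ← Finset.prod_mul_distrib]
    refine Finset.prod_induction _ (fun t : ℝ => 1 ≤ t) (fun _ _ => one_le_mul_of_one_le_of_one_le)
      le_rfl fun j _ => ?_
    have := hzv j
    rw [← one_le_sq_iff₀ (by positivity), mul_pow, Real.sq_sqrt (Nat.cast_nonneg _)]
    exact this
  have h4 : (2 : ℝ) ^ ((n : ℝ) / 2 - 1) = 2 ^ ((n : ℝ) / 2) / 2 := by
    rw [Real.rpow_sub two_pos, Real.rpow_one]
  have h5 : p ≤ 2 ^ ((n : ℝ) / 2) / 2 * m := by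
    have := mul_le_mul_of_nonneg_left h2 hm0
    linarith
  rw [h4]
  have h6 : 0 ≤ (n : ℝ) ^ ((n : ℝ) / 2) := by positivity
  nlinarith [mul_le_mul_of_nonneg_left h5 h6]

theorem prod_abs_le_inv_rpow {n : ℕ} (hn : 1 ≤ n) (x : EuclideanSpace ℝ (Fin n))
    (hx : ‖x‖ ≤ 1) : ∏ j, |x j| ≤ ((n : ℝ) ^ ((n : ℝ) / 2))⁻¹ := by
  have hn0 : (0 : ℝ) < n := by exact_mod_cast hn
  have h1 := Real.geom_mean_le_arith_mean Finset.univ (fun _ : Fin n => (1 : ℝ))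
    (fun j => x j ^ 2) (fun _ _ => zero_le_one) (by simpa using hn0) (fun _ _ => sq_nonneg _)
  simp only [Real.rpow_one, Finset.sum_const, Finset.card_univ, Fintype.card_fin, nsmul_eq_mul,
    mul_one, one_mul, ← EuclideanSpace.real_norm_sq_eq] at h1
  have hP0 : 0 ≤ ∏ j, x j ^ 2 := Finset.prod_nonneg fun _ _ => sq_nonneg _
  have h2 : (∏ j, x j ^ 2) ^ ((n : ℝ)⁻¹) ≤ (n : ℝ)⁻¹ := by
    refine h1.trans ?_
    rw [div_eq_mul_inv]
    exact mul_le_of_le_one_left (inv_pos.2 hn0).le (pow_le_one₀ (norm_nonneg _) hx)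
  have h3 : ∏ j, x j ^ 2 ≤ ((n : ℝ)⁻¹) ^ n := by
    have := pow_le_pow_left₀ (Real.rpow_nonneg hP0 _) h2 n
    rwa [Real.rpow_inv_natCast_pow hP0 (by omega)] at this
  rw [← sqrt_natCast_pow_eq_rpow]
  refine (sq_le_sq₀ (Finset.prod_nonneg fun _ _ => abs_nonneg _) (by positivity)).1 ?_
  rw [← Finset.prod_pow, inv_pow, ← pow_mul, mul_comm n 2, pow_mul,
    Real.sq_sqrt hn0.le, ← inv_pow]
  simpa only [sq_abs] using h3

/-! ### Bounds for the polarization constant -/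

theorem ofReal_rpow_le_linearPolarizationConst {n : ℕ} (hn : 1 ≤ n) :
    ENNReal.ofReal ((n : ℝ) ^ ((n : ℝ) / 2)) ≤
      linearPolarizationConst ℝ (EuclideanSpace ℝ (Fin n)) n := by
  have hn0 : (0 : ℝ) < n := by exact_mod_cast hn
  have hpos : (0 : ℝ) < (n : ℝ) ^ ((n : ℝ) / 2) := Real.rpow_pos_of_pos hn0 _
  refine le_sInf fun M hM => ?_
  have h1 := hM fun j => EuclideanSpace.proj j
  have h2 : (1 : ℝ≥0∞) ≤
      ∏ j : Fin n, ‖(EuclideanSpace.proj j : EuclideanSpace ℝ (Fin n) →L[ℝ] ℝ)‖ₑ := by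
    refine Finset.one_le_prod' fun j _ => ?_
    have h3 := (EuclideanSpace.proj j : EuclideanSpace ℝ (Fin n) →L[ℝ] ℝ).le_opNorm
      (EuclideanSpace.single j 1)
    have h4 : (1 : ℝ) ≤ ‖(EuclideanSpace.proj j : EuclideanSpace ℝ (Fin n) →L[ℝ] ℝ)‖ := by
      simpa using h3
    rw [← ofReal_norm]
    exact ENNReal.one_le_ofReal.2 h4
  have h5 : unitBallNorm (fun x : EuclideanSpace ℝ (Fin n) =>
      ∏ j, (EuclideanSpace.proj j : EuclideanSpace ℝ (Fin n) →L[ℝ] ℝ) x) ≤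
        (ENNReal.ofReal ((n : ℝ) ^ ((n : ℝ) / 2)))⁻¹ := by
    refine iSup₂_le fun x hx => ?_
    rw [← ENNReal.ofReal_inv_of_pos hpos, ← ofReal_norm]
    refine ENNReal.ofReal_le_ofReal ?_
    rw [norm_prod]
    exact prod_abs_le_inv_rpow hn x (by simpa using hx)
  have h6 := h2.trans (h1.trans (mul_le_mul_right h5 M))
  rw [← div_eq_mul_inv, ENNReal.le_div_iff_mul_le (by simp [hpos]) (by simp), one_mul] at h6
  exact h6

theorem linearPolarizationConst_le_ofReal {n : ℕ} (hn : 2 ≤ n) :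
    linearPolarizationConst ℝ (EuclideanSpace ℝ (Fin n)) n ≤
      ENNReal.ofReal ((2 : ℝ) ^ ((n : ℝ) / 2 - 1) * (n : ℝ) ^ ((n : ℝ) / 2)) := by
  have hn0 : (0 : ℝ) < n := by exact_mod_cast (by omega : 0 < n)
  have hC : (0 : ℝ) < (2 : ℝ) ^ ((n : ℝ) / 2 - 1) * (n : ℝ) ^ ((n : ℝ) / 2) :=
    mul_pos (Real.rpow_pos_of_pos two_pos _) (Real.rpow_pos_of_pos hn0 _)
  refine sInf_le fun f => ?_
  by_cases hf : ∃ j, f j = 0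
  · obtain ⟨j, hj⟩ := hf
    rw [Finset.prod_eq_zero (Finset.mem_univ j)
      (by rw [hj, ← ofReal_norm, norm_zero, ENNReal.ofReal_zero])]
    exact zero_le
  push Not at hf
  set U := unitBallNorm (fun x : EuclideanSpace ℝ (Fin n) => ∏ j, f j x) with hU
  -- Excluding `⊤` lets the remaining argument run in `ℝ` through `U.toReal`.
  rcases eq_or_ne U ⊤ with hUt | hUt
  · rw [hUt, ENNReal.mul_top (by simpa using hC)]
    exact le_top
  have hbound : ∀ e : EuclideanSpace ℝ (Fin n), ‖e‖ ≤ 1 → ∏ j, |f j e| ≤ U.toReal := by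
    intro e he
    have h1 : ‖∏ j, f j e‖ₑ ≤ U :=
      le_iSup₂ (f := fun (x : EuclideanSpace ℝ (Fin n)) (_ : x ∈ Metric.closedBall 0 1) =>
        ‖∏ j, f j x‖ₑ) e (by simpa using he)
    have h2 := ENNReal.toReal_mono hUt h1
    rwa [toReal_enorm, norm_prod] at h2
  have hpos : ∀ j, 0 < ‖f j‖ := fun j => norm_pos_iff.2 (hf j)
  have hP : 0 < ∏ j, ‖f j‖ := Finset.prod_pos fun j _ => hpos j
  -- The normalized Riesz representatives are unit vectors, and `m` absorbs the product of the
  -- norms.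
  have h := one_le_mul_of_prod_abs_inner_le (ι := Fin n) (by simpa using hn)
    (fun j => ‖f j‖⁻¹ • (InnerProductSpace.toDual ℝ (EuclideanSpace ℝ (Fin n))).symm (f j))
    (fun j => by
      rw [norm_smul, norm_inv, norm_norm, LinearIsometryEquiv.norm_map,
        inv_mul_cancel₀ (hpos j).ne'])
    (m := (∏ j, ‖f j‖)⁻¹ * U.toReal) (fun e he => by
      refine le_of_eq_of_le ?_ (mul_le_mul_of_nonneg_left (hbound e he) (inv_pos.2 hP).le)
      rw [← Finset.prod_inv_distrib, ← Finset.prod_mul_distrib]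
      refine Finset.prod_congr rfl fun j _ => ?_
      rw [real_inner_smul_left, InnerProductSpace.toDual_symm_apply, abs_mul, abs_inv, abs_norm])
  rw [Fintype.card_fin] at h
  have h2 : ∏ j, ‖f j‖ ≤
      (2 : ℝ) ^ ((n : ℝ) / 2 - 1) * (n : ℝ) ^ ((n : ℝ) / 2) * U.toReal := by
    have := mul_le_mul_of_nonneg_left h hP.le
    rwa [mul_one, mul_left_comm, mul_inv_cancel_left₀ hP.ne'] at this
  have h3 := ENNReal.ofReal_le_ofReal h2
  rw [ENNReal.ofReal_mul hC.le, ENNReal.ofReal_toReal hUt,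
    ENNReal.ofReal_prod_of_nonneg fun j _ => norm_nonneg _] at h3
  simpa only [ofReal_norm] using h3

theorem mainTheorem4 (n : ℕ) (hn : 1 ≤ n) :
    ENNReal.ofReal ((n : ℝ) ^ ((n : ℝ) / 2)) ≤
        linearPolarizationConst ℝ (EuclideanSpace ℝ (Fin n)) n ∧
      (2 ≤ n →
        linearPolarizationConst ℝ (EuclideanSpace ℝ (Fin n)) n ≤
          ENNReal.ofReal ((2 : ℝ) ^ ((n : ℝ) / 2 - 1) * (n : ℝ) ^ ((n : ℝ) / 2))) :=
  ⟨ofReal_rpow_le_linearPolarizationConst hn, linearPolarizationConst_le_ofReal⟩
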